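/- Let $(Y,\xi,A)$ be a random triple with $A>0$ and $Y\mid(\xi,A)\sim N(\xi,A)$. Put $a^*(v)=\mathbb E(Y\mid A=v)$, $b^*(v)=v/\mathrm{Var}(Y\mid A=v)$ and $r(a,b)=\mathbb E\{Y-b(A)[Y-a(A)]-\xi\}^2$. Assume $r(a^*,b^*)=0$ (so that $\xi=a^*(A)$ almost surely) and that (a version of) $a^*$ satisfies $$|a^*(u)-a^*(v)|^2\le L\,|u-v|^2\qquad\text{for all } u,v>0,$$ with a constant $L>0$, i.e. $a^*$ is $\sqrt L$-Lipschitz on $(0,\infty)$. Let $(X_i,\theta_i,V_i)$, $i=1,\dots,n$, $n\ge 1$, be i.i.d. copies of $(Y,\xi,A)$, let $\mathbf V=(V_1,\dots,V_n)$ and $V_{\max}=\max_i V_i$. Given pairwise disjoint intervals $J_1,\dots,J_m$ (which may depend on $\mathbf V$), put $\mathcal I_k=\{i:V_i\in J_k\}$, $n_k=|\mathcal I_k|$, $\overline V_k=\sum_{i\in\mathcal I_k}V_i/n_k$, $\overline X_k=\sum_{i\in\mathcal I_k}X_i/n_k$, $s_k^2=\sum_{i\in\mathcal I_k}(X_i-\overline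 X_k)^2/(n_k\vee 2-1)$ and $c_k^*=\{1-2(\max_{i\in\mathcal I_k}V_i/\overline V_k)/(n_k-1)\}_+$ ($c_k^*=0$ if $n_k=1$). The group-linear estimator is $$\widehat\theta_i=X_i-\min\bigl(1,c_k^*\overline V_k/s_k^2\bigr)(X_i-\overline X_k)\ \text{ if } i\in\mathcal I_k,\qquad \widehat\theta_i=X_i\ \text{ if } V_i\notin\textstyle\bigcup_k J_k .$$ Suppose that the intervals $J_k$ all have the same length $|J|=\bigl(\tfrac{10V_{\max}^2}{nL}\bigr)^{1/3}$ and together contain $V_1,\dots,V_n$, and that $|J|\le V_{\max}$ (equivalently $nLV_{\max}\ge 10$). Then $$\frac1n\sum_{i=1}^n\mathbb E\bigl[(\widehat\theta_i-\theta_i)^2\,\big|\,\mathbf V\bigr]\le 2\Bigl(\frac{10V_{\max}^2\sqrt L}{n}\Bigr)^{2/3}$$ for almost every value of $\mathbf V$. The same bound holds for every deterministic $\mathbf V\in(0,\infty)^n$ satisfying these conditions, when $\theta_i=a^*(V_i)$ and the $X_i\sim N(a^*(V_i),V_i)$ are independent. -/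

import Mathlib

open MeasureTheory ProbabilityTheory Set
open scoped ENNReal NNReal

noncomputable section

namespace GroupLinear

/-! ### The population `(Y, ξ, A)` and the oracle linear rule

A population is a law `Q` on `ℝ × ℝ × ℝ`; a point is a triple `(y, ξ, A)`. -/

/-- `(Y, ξ, A) ∼ Q` with positive variances `A` and `Y | (ξ, A) ∼ N(ξ, A)`. -/
structure IsNormalPopulation (Q : Measure (ℝ × ℝ × ℝ)) [IsProbabilityMeasure Q] : Prop where
  var_pos : ∀ᵐ t ∂Q, 0 < t.2.2
  cond_normal : ∀ᵐ p ∂(Q.map Prod.snd),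
    condDistrib Prod.fst Prod.snd Q p = gaussianReal p.1 p.2.toNNReal

/-- The marginal law of `A`. -/
def varLaw (Q : Measure (ℝ × ℝ × ℝ)) : Measure ℝ := Q.map fun t => t.2.2

/-- The regular conditional distribution of `Y` given `A`. -/
def condYgivenA (Q : Measure (ℝ × ℝ × ℝ)) [IsProbabilityMeasure Q] : Kernel ℝ ℝ :=
  condDistrib (fun t : ℝ × ℝ × ℝ => t.1) (fun t => t.2.2) Q

/-- `a*(v) = E(Y | A = v)`, determined up to null sets of the law of `A`. -/
def oracleA (Q : Measure (ℝ × ℝ × ℝ)) [IsProbabilityMeasure Q] (v : ℝ) : ℝ :=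
  ∫ y, y ∂(condYgivenA Q v)

/-- `b*(v) = v / Var(Y | A = v)`, determined up to null sets of the law of `A`. -/
def oracleB (Q : Measure (ℝ × ℝ × ℝ)) [IsProbabilityMeasure Q] (v : ℝ) : ℝ :=
  v / variance (fun y : ℝ => y) (condYgivenA Q v)

/-- The Bayes risk `r(a, b) = E {Y - b(A) [Y - a(A)] - ξ}²`, with values in `[0, ∞]`. -/
def bayesRisk (Q : Measure (ℝ × ℝ × ℝ)) (a b : ℝ → ℝ) : ℝ≥0∞ :=
  ∫⁻ t, ENNReal.ofReal ((t.1 - b t.2.2 * (t.1 - a t.2.2) - t.2.1) ^ 2) ∂Q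

/-! ### The group-linear estimator -/

/-- `I_k = {i : V_i ∈ J_k}`. -/
def block {n : ℕ} (v : Fin n → ℝ) (J : Set ℝ) : Finset (Fin n) :=
  open Classical in Finset.univ.filter fun i => v i ∈ J

/-- The average of `z` over a block. -/
def blockMean {n : ℕ} (I : Finset (Fin n)) (z : Fin n → ℝ) : ℝ :=
  (∑ i ∈ I, z i) / (I.card : ℝ)

/-- `s_k² = ∑_{i ∈ I_k} (X_i - X̄_k)² / (n_k ∨ 2 - 1)`. -/
def blockS2 {n : ℕ} (I : Finset (Fin n)) (x : Fin n → ℝ) : ℝ :=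
  (∑ i ∈ I, (x i - blockMean I x) ^ 2) / (max (I.card : ℝ) 2 - 1)

/-- `max_{i ∈ I_k} V_i`. -/
def blockMax {n : ℕ} (I : Finset (Fin n)) (v : Fin n → ℝ) : ℝ := ⨆ i : I, v i

/-- The constant `c_k* = {1 - 2 (max_{i ∈ I_k} V_i / V̄_k) / (n_k - 1)}₊`. With `n_k ∨ 2 - 1` in
place of `n_k - 1`, a block with one point gets `c_k* = 0`, which is what the formula gives when
division of a positive number by zero is read as `∞`. -/
def cStar {n : ℕ} (v : Fin n → ℝ) (J : Set ℝ) : ℝ :=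
  max 0 (1 - 2 * (blockMax (block v J) v / blockMean (block v J) v) /
    (max ((block v J).card : ℝ) 2 - 1))

/-- The group-linear estimator with bins `J_1, …, J_m` and constants `c_1, …, c_m`:
`X_i - min(1, c_k V̄_k / s_k²) (X_i - X̄_k)` if `V_i ∈ J_k`, and `X_i` if `V_i` lies in no bin.
The bins are meant to be disjoint, so the sum has at most one term. If `s_k² = 0` then
`X_i = X̄_k`, and the value of the quotient is irrelevant. -/
def groupLinear {n m : ℕ} (J : Fin m → Set ℝ) (c : Fin m → ℝ) (v x : Fin n → ℝ) (i : Fin n) : ℝ :=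
  open Classical in
  x i - ∑ k ∈ Finset.univ.filter (fun k => v i ∈ J k),
    min 1 (c k * blockMean (block v (J k)) v / blockS2 (block v (J k)) x) *
      (x i - blockMean (block v (J k)) x)

/-- `J_1, …, J_m` are pairwise disjoint intervals of length `w` that cover all the `V_i`. -/
structure IsEqualBinning {n m : ℕ} (J : Fin m → Set ℝ) (w : ℝ) (v : Fin n → ℝ) : Prop where
  interval : ∀ k, (J k).OrdConnected
  length : ∀ k, volume (J k) = ENNReal.ofReal w
  disjoint : Pairwise fun k l => Disjoint (J k) (J l)
  cover : ∀ i, ∃ k, v i ∈ J k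

/-- `V_max = max_i V_i`. -/
def vMax {n : ℕ} (v : Fin n → ℝ) : ℝ := ⨆ i, v i

/-- The bin width `|J| = (10 V_max² / (n L))^{1/3}`. -/
def binWidth {n : ℕ} (L : ℝ) (v : Fin n → ℝ) : ℝ :=
  (10 * vMax v ^ 2 / (n * L)) ^ (1 / 3 : ℝ)

/-- The normalized risk `(1/n) ∑ E (θ̂_i - θ_i)²`, with values in `[0, ∞]`, of the group-linear
estimator with `c_k = c_k*` when the variances are `v` and `(X, θ)` has law `M`. -/
def groupLinearRisk {n m : ℕ} (J : Fin m → Set ℝ) (v : Fin n → ℝ)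
    (M : Measure ((Fin n → ℝ) × (Fin n → ℝ))) : ℝ≥0∞ :=
  (n : ℝ≥0∞)⁻¹ * ∑ i, ∫⁻ z,
    ENNReal.ofReal ((groupLinear J (fun k => cStar v (J k)) v z.1 i - z.2 i) ^ 2) ∂M

/-- The law of `(X, θ)` in the regression model with fixed variances `v`: `θ_i = a(v_i)` and the
`X_i ∼ N(a(v_i), v_i)` are independent. -/
def regressionLaw {n : ℕ} (a : ℝ → ℝ) (v : Fin n → ℝ) :
    Measure ((Fin n → ℝ) × (Fin n → ℝ)) :=
  (Measure.pi fun i => gaussianReal (a (v i)) (v i).toNNReal).map fun x => (x, fun i => a (v i))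

end GroupLinear

end

namespace GroupLinear

/-! The core is a risk bound for fixed variances. Within a block of `N` points write `M` for the
largest variance, `S` for the sum of squares about the block mean, `W = (1 - 1/N) ∑ v_i` and `T` for
the value of `S` at the true means. When `C = W - 2M > 0`, the rule subtracts `C (x_i - x̄) / max S
C`. Stein's identity expresses the risk as `∑ v_i` plus the mean of an unbiased estimate. Since `v_i
≤ M`, that estimate is at most `-C²/S` for `S > C`, and at most `S - 2C`, the tangent at `C`, for `S
≤ C`. This bound is concave in `S`, so it lies below its tangent at `E S = W + T`
(`sum_sq_shrinkage_sub_le`), and Jensen's inequality gives `∑ v_i - C²/(W + T) ≤ 5M + T`. Blocks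
left unshrunk satisfy the same bound (`sum_lintegral_block_le`).

Let `w` be the bin width. The Lipschitz condition gives `T ≤ N L w² / 2`, and `w ≤ V_max` allows at
most `3 V_max / w` occupied bins. Summing, the total risk is at most `15 V_max² / w + n L w² / 2`.
As `w³ = 10 V_max² / (n L)`, the first term is `(3/2) n L w²` and the sum is `2 n L w²`.

For the random sample, zero oracle risk makes an affine function of `Y` vanish almost surely under a
nondegenerate normal law. Its slope must then be zero, so `ξ = a*(A)` (`ae_eq_oracleA`), and given
`V = v` the sample follows the fixed-variance model. -/

/-! ### Stein's identity in one and several dimensions -/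

open Filter Topology in
/-- The fundamental theorem of calculus on the line for a continuous function that vanishes at
infinity and is differentiable off a countable set. -/
theorem integral_eq_zero_of_hasDerivAt_off_countable {f f' : ℝ → ℝ} {s : Set ℝ}
    (hs : s.Countable) (hf : Continuous f) (hd : ∀ t, t ∉ s → HasDerivAt f (f' t) t)
    (hf' : Integrable f') (hbot : Tendsto f atBot (𝓝 0)) (htop : Tendsto f atTop (𝓝 0)) :
    ∫ t, f' t = 0 := by
  have h1 : Tendsto (fun r : ℝ => ∫ t in (-r)..r, f' t) atTop (𝓝 (∫ t, f' t)) :=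
    intervalIntegral_tendsto_integral hf' tendsto_neg_atTop_atBot tendsto_id
  have h2 : ∀ r : ℝ, ∫ t in (-r)..r, f' t = f r - f (-r) := fun r =>
    integral_eq_of_hasDerivAt_off_countable f f' hs hf.continuousOn
      (fun t ht => hd t ht.2) hf'.intervalIntegrable
  simp_rw [h2] at h1
  have h3 := htop.sub (hbot.comp tendsto_neg_atTop_atBot)
  simpa using tendsto_nhds_unique h1 h3

theorem hasDerivAt_gaussianPDFReal (μ : ℝ) {v : ℝ≥0} (hv : v ≠ 0) (t : ℝ) :
    HasDerivAt (gaussianPDFReal μ v) (-((t - μ) / v) * gaussianPDFReal μ v t) t := by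
  have hv' : (v : ℝ) ≠ 0 := by exact_mod_cast hv
  have h1 : HasDerivAt (fun x : ℝ => -(x - μ) ^ 2 / (2 * v)) (-((t - μ) / v)) t := by
    have := ((((hasDerivAt_id t).sub_const μ).pow 2).neg).div_const (2 * (v : ℝ))
    convert! this using 1
    simp
    field_simp
  have := (h1.exp).const_mul (√(2 * Real.pi * v))⁻¹
  rw [gaussianPDFReal_def]
  convert! this using 1
  ring

open Filter Topology in
theorem tendsto_gaussianPDFReal_cocompact (μ : ℝ) {v : ℝ≥0} (hv : v ≠ 0) :
    Tendsto (gaussianPDFReal μ v) (cocompact ℝ) (𝓝 0) := by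
  have hv' : (0 : ℝ) < v := by exact_mod_cast pos_iff_ne_zero.2 hv
  have h1 : Tendsto (fun x : ℝ => ‖x - μ‖) (cocompact ℝ) atTop :=
    tendsto_norm_cocompact_atTop.comp (Homeomorph.subRight μ).isClosedEmbedding.tendsto_cocompact
  have h2 : Tendsto (fun x : ℝ => -(x - μ) ^ 2 / (2 * v)) (cocompact ℝ) atBot := by
    have := (((tendsto_pow_atTop two_ne_zero).comp h1).atTop_div_const
      (by positivity : (0 : ℝ) < 2 * v))
    have := tendsto_neg_atTop_atBot.comp this
    refine this.congr fun x => ?_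
    simp [neg_div]
  have := (Real.tendsto_exp_atBot.comp h2).const_mul (√(2 * Real.pi * v))⁻¹
  rw [gaussianPDFReal_def]
  simpa using this

theorem integrable_sub_gaussianReal (μ m : ℝ) (v : ℝ≥0) :
    Integrable (fun t => t - m) (gaussianReal μ v) :=
  ((memLp_id_gaussianReal 1).integrable (by simp)).sub (integrable_const m)

open Filter Topology in
/-- Stein's identity for a bounded continuous function that is differentiable off a countable set,
with bounded derivative. -/
theorem stein_gaussianReal (μ : ℝ) {v : ℝ≥0} (hv : v ≠ 0) {g g' : ℝ → ℝ} {s : Set ℝ}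
    (hs : s.Countable) (hg : Continuous g) (hd : ∀ t, t ∉ s → HasDerivAt g (g' t) t)
    (hg'm : Measurable g') {K K' : ℝ} (hK : ∀ t, |g t| ≤ K) (hK' : ∀ t, |g' t| ≤ K') :
    ∫ t, (t - μ) * g t ∂(gaussianReal μ v) = v * ∫ t, g' t ∂(gaussianReal μ v) := by
  have hv' : (v : ℝ) ≠ 0 := by exact_mod_cast hv
  have hI1 : Integrable (fun t => (t - μ) * g t) (gaussianReal μ v) :=
    (integrable_sub_gaussianReal μ μ v).mul_bdd (c := K) hg.aestronglyMeasurable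
      (ae_of_all _ fun t => by simpa using hK t)
  have hI2 : Integrable g' (gaussianReal μ v) :=
    Integrable.of_bound hg'm.aestronglyMeasurable K' (ae_of_all _ fun t => by simpa using hK' t)
  have hint : ∀ h : ℝ → ℝ, Integrable h (gaussianReal μ v) →
      Integrable (fun t => gaussianPDFReal μ v t * h t) := by
    intro h hh
    rw [gaussianReal_of_var_ne_zero μ hv] at hh
    have := (integrable_withDensity_iff_integrable_smul' (measurable_gaussianPDF μ v)
      (ae_of_all _ fun _ => gaussianPDF_lt_top)).1 hh
    simpa [toReal_gaussianPDF] using this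
  have hcont : Continuous (gaussianPDFReal μ v) :=
    continuous_iff_continuousAt.2 fun t => (hasDerivAt_gaussianPDFReal μ hv t).continuousAt
  have hlim : Tendsto (fun t => gaussianPDFReal μ v t * g t) (cocompact ℝ) (𝓝 0) :=
    (tendsto_gaussianPDFReal_cocompact μ hv).zero_mul_isBoundedUnder_le
      ⟨K, eventually_map.2 (Eventually.of_forall hK)⟩
  -- The integrand is the derivative of density times `g`, because the density `p` satisfies `p' =
  -- -((t - μ)/v) p`.
  have key : ∫ t, (gaussianPDFReal μ v t * g' t
      - (v : ℝ)⁻¹ * (gaussianPDFReal μ v t * ((t - μ) * g t))) = 0 := by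
    refine integral_eq_zero_of_hasDerivAt_off_countable hs (hcont.mul hg) (fun t ht => ?_)
      ((hint _ hI2).sub ((hint _ hI1).const_mul _)) (hlim.mono_left atBot_le_cocompact)
      (hlim.mono_left atTop_le_cocompact)
    convert! (hasDerivAt_gaussianPDFReal μ hv t).mul (hd t ht) using 1
    field_simp
    ring
  rw [integral_sub (hint _ hI2) ((hint _ hI1).const_mul _), integral_const_mul] at key
  rw [integral_gaussianReal_eq_integral_smul hv, integral_gaussianReal_eq_integral_smul hv]
  simp only [smul_eq_mul]
  have := congrArg (fun r => (v : ℝ) * r) key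
  simp only [mul_sub, mul_inv_cancel_left₀ hv', mul_zero] at this
  linarith

theorem measurable_update_prod {ι : Type*} [DecidableEq ι] {α : ι → Type*}
    [∀ i, MeasurableSpace (α i)] (i : ι) :
    Measurable fun p : (∀ j, α j) × α i => Function.update p.1 i p.2 := by
  refine measurable_pi_iff.2 fun j => ?_
  by_cases h : j = i
  · subst h; simpa using measurable_snd
  · simp only [Function.update_of_ne h]
    exact (measurable_pi_apply j).comp measurable_fst

/-- Resampling one coordinate preserves a product of probability measures. -/
theorem measurePreserving_update {ι : Type*} [Fintype ι] [DecidableEq ι] {α : ι → Type*}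
    [∀ i, MeasurableSpace (α i)] (μ : ∀ i, Measure (α i)) [∀ i, IsProbabilityMeasure (μ i)]
    (i : ι) :
    MeasurePreserving (fun p : (∀ j, α j) × α i => Function.update p.1 i p.2)
      ((Measure.pi μ).prod (μ i)) (Measure.pi μ) where
  measurable := measurable_update_prod i
  map_eq := by
    refine (Measure.pi_eq fun s hs => ?_).symm
    rw [Measure.map_apply (measurable_update_prod i) (MeasurableSet.univ_pi hs)]
    have : (fun p : (∀ j, α j) × α i => Function.update p.1 i p.2) ⁻¹' univ.pi s =
        univ.pi (Function.update s i univ) ×ˢ s i := by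
      ext p
      simp only [mem_preimage, mem_pi, mem_univ, true_imp_iff, mem_prod]
      constructor
      · intro h
        refine ⟨fun j => ?_, by simpa using h i⟩
        by_cases hj : j = i
        · subst hj; simp
        · simpa [Function.update_of_ne hj] using h j
      · rintro ⟨h1, h2⟩ j
        by_cases hj : j = i
        · subst hj; simpa using h2
        · simpa [Function.update_of_ne hj] using h1 j
    rw [this, Measure.prod_prod, Measure.pi_pi, ← Finset.prod_erase_mul _ _ (Finset.mem_univ i),
      ← Finset.prod_erase_mul _ (fun j => μ j (s j)) (Finset.mem_univ i)]
    simp only [Function.update_self, measure_univ, mul_one]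
    congr 1
    refine Finset.prod_congr rfl fun j hj => ?_
    rw [Function.update_of_ne (Finset.ne_of_mem_erase hj)]

/-- Stein's identity in one coordinate of a product of normal laws. -/
theorem stein_pi {n : ℕ} (θ : Fin n → ℝ) (v : Fin n → ℝ≥0) (i : Fin n) (hv : v i ≠ 0)
    {f f' : (Fin n → ℝ) → ℝ} (hf : Continuous f) (hf'm : Measurable f')
    (hd : ∀ x, ∃ s : Set ℝ, s.Countable ∧ ∀ t, t ∉ s →
      HasDerivAt (fun r => f (Function.update x i r)) (f' (Function.update x i t)) t)
    {K K' : ℝ} (hK : ∀ x, |f x| ≤ K) (hK' : ∀ x, |f' x| ≤ K') :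
    ∫ x, (x i - θ i) * f x ∂(Measure.pi fun j => gaussianReal (θ j) (v j)) =
      v i * ∫ x, f' x ∂(Measure.pi fun j => gaussianReal (θ j) (v j)) := by
  set μ := Measure.pi fun j => gaussianReal (θ j) (v j)
  have hmp := measurePreserving_update (fun j => gaussianReal (θ j) (v j)) i
  have hI0 : Integrable (fun x : Fin n → ℝ => x i - θ i) μ :=
    (measurePreserving_eval (fun j => gaussianReal (θ j) (v j)) i).integrable_comp_of_integrable
      (integrable_sub_gaussianReal (θ i) (θ i) (v i))
  have hI1 : Integrable (fun x : Fin n → ℝ => (x i - θ i) * f x) μ :=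
    hI0.mul_bdd (c := K) hf.aestronglyMeasurable (ae_of_all _ fun t => by simpa using hK t)
  have hI2 : Integrable f' μ :=
    Integrable.of_bound hf'm.aestronglyMeasurable K' (ae_of_all _ fun t => by simpa using hK' t)
  -- Resampling coordinate `i` turns the integral into an iterated one whose inner variable is a
  -- single normal, where the one-dimensional identity applies.
  have hred : ∀ h : (Fin n → ℝ) → ℝ, Integrable h μ →
      ∫ x, h x ∂μ = ∫ x, ∫ t, h (Function.update x i t) ∂(gaussianReal (θ i) (v i)) ∂μ := by
    intro h hh
    rw [← integral_prod (fun p : (Fin n → ℝ) × ℝ => h (Function.update p.1 i p.2))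
      (hmp.integrable_comp_of_integrable hh), ← integral_map hmp.measurable.aemeasurable, hmp.map_eq]
    rw [hmp.map_eq]
    exact hh.aestronglyMeasurable
  rw [hred _ hI1, hred _ hI2, ← integral_const_mul]
  refine integral_congr_ae (ae_of_all _ fun x => ?_)
  obtain ⟨s, hs, hds⟩ := hd x
  have hc : Continuous fun t : ℝ => Function.update x i t := continuous_const.update i continuous_id
  have := stein_gaussianReal (θ i) hv hs (hf.comp hc) hds (hf'm.comp hc.measurable)
    (fun t => hK _) (fun t => hK' _)
  simpa using this

/-! ### The shrinkage term: bounds, derivative, pointwise risk estimate -/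

/-- The sum of squared deviations from the block mean. -/
noncomputable def blockSS {n : ℕ} (I : Finset (Fin n)) (x : Fin n → ℝ) : ℝ :=
  ∑ i ∈ I, (x i - blockMean I x) ^ 2

/-- The shrinkage `min(1, C / S) (x_i - x̄)`, written without the division by zero at `S = 0`. -/
noncomputable def shrinkage {n : ℕ} (I : Finset (Fin n)) (C : ℝ) (i : Fin n) (x : Fin n → ℝ) : ℝ :=
  C * (x i - blockMean I x) / max (blockSS I x) C

/-- The partial derivative of `shrinkage I C i` in the coordinate `i`, where it exists. -/
noncomputable def shrinkageDeriv {n : ℕ} (I : Finset (Fin n)) (C : ℝ) (i : Fin n)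
    (x : Fin n → ℝ) : ℝ :=
  if blockSS I x ≤ C then 1 - 1 / (I.card : ℝ) else
    C * ((1 - 1 / (I.card : ℝ)) * blockSS I x - 2 * (x i - blockMean I x) ^ 2) / blockSS I x ^ 2

section Algebra

variable {n : ℕ} {I : Finset (Fin n)}

theorem blockSS_eq (hI : I.Nonempty) (x : Fin n → ℝ) :
    blockSS I x = ∑ i ∈ I, x i ^ 2 - (∑ i ∈ I, x i) ^ 2 / I.card := by
  have hN : (I.card : ℝ) ≠ 0 := by exact_mod_cast hI.card_pos.ne'
  simp only [blockSS, sub_sq, Finset.sum_add_distrib, Finset.sum_sub_distrib, Finset.sum_const,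
    nsmul_eq_mul, ← Finset.sum_mul, ← Finset.mul_sum, blockMean]
  field_simp
  ring

theorem blockSS_nonneg (I : Finset (Fin n)) (x : Fin n → ℝ) : 0 ≤ blockSS I x :=
  Finset.sum_nonneg fun _ _ => sq_nonneg _

theorem sq_sub_blockMean_le {i : Fin n} (hi : i ∈ I) (x : Fin n → ℝ) :
    (x i - blockMean I x) ^ 2 ≤ blockSS I x :=
  Finset.single_le_sum (f := fun j => (x j - blockMean I x) ^ 2) (fun _ _ => sq_nonneg _) hi

theorem continuous_blockMean : Continuous (blockMean I) := by
  unfold blockMean; fun_prop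

theorem continuous_blockSS : Continuous (blockSS I) := by
  have := continuous_blockMean (I := I)
  unfold blockSS; fun_prop

theorem continuous_shrinkage {C : ℝ} (hC : 0 < C) (i : Fin n) : Continuous (shrinkage I C i) := by
  have h1 := continuous_blockMean (I := I)
  have h2 := continuous_blockSS (I := I)
  unfold shrinkage
  refine Continuous.div (by fun_prop) (by fun_prop) fun x => ?_
  exact (lt_of_lt_of_le hC (le_max_right _ _)).ne'

theorem measurable_shrinkageDeriv (C : ℝ) (i : Fin n) : Measurable (shrinkageDeriv I C i) := by
  have h1 := (continuous_blockMean (I := I)).measurable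
  have h2 := (continuous_blockSS (I := I)).measurable
  unfold shrinkageDeriv
  exact Measurable.ite (measurableSet_le h2 measurable_const) measurable_const (by fun_prop)

theorem sq_shrinkage_le {C : ℝ} (hC : 0 < C) {i : Fin n} (hi : i ∈ I) (x : Fin n → ℝ) :
    shrinkage I C i x ^ 2 ≤ C := by
  have h := sq_sub_blockMean_le hi x
  have hS := blockSS_nonneg I x
  have hm1 := le_max_left (blockSS I x) C
  have hm2 := le_max_right (blockSS I x) C
  rw [shrinkage, div_pow, mul_pow, div_le_iff₀ (by positivity)]
  calc C ^ 2 * (x i - blockMean I x) ^ 2 ≤ C ^ 2 * max (blockSS I x) C := by gcongr; linarith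
    _ = C * (C * max (blockSS I x) C) := by ring
    _ ≤ C * (max (blockSS I x) C * max (blockSS I x) C) := by gcongr
    _ = _ := by ring

theorem abs_shrinkage_le {C : ℝ} (hC : 0 < C) {i : Fin n} (hi : i ∈ I) (x : Fin n → ℝ) :
    |shrinkage I C i x| ≤ √C :=
  Real.abs_le_sqrt (sq_shrinkage_le hC hi x)

theorem abs_shrinkageDeriv_le {C : ℝ} (hC : 0 < C) {i : Fin n} (hi : i ∈ I) (x : Fin n → ℝ) :
    |shrinkageDeriv I C i x| ≤ 2 := by
  have hN : (1 : ℝ) ≤ I.card := by exact_mod_cast Finset.card_pos.2 ⟨i, hi⟩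
  have hN1 : 1 / (I.card : ℝ) ≤ 1 := by rw [div_le_one (by linarith)]; exact hN
  have hN0 : 0 ≤ 1 / (I.card : ℝ) := by positivity
  have h := sq_sub_blockMean_le hi x
  unfold shrinkageDeriv
  split_ifs with hS
  · rw [abs_le]; constructor <;> linarith
  · push Not at hS
    have hS0 : 0 < blockSS I x := hC.trans hS
    rw [abs_div, abs_mul, abs_of_pos hC, abs_of_pos (pow_pos hS0 2), div_le_iff₀ (pow_pos hS0 2)]
    have : |(1 - 1 / (I.card : ℝ)) * blockSS I x - 2 * (x i - blockMean I x) ^ 2|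
        ≤ 2 * blockSS I x := by
      rw [abs_le]
      constructor <;> nlinarith [sq_nonneg (x i - blockMean I x)]
    calc C * _ ≤ blockSS I x * (2 * blockSS I x) := by gcongr
      _ = _ := by ring

theorem sum_update_of_mem {i : Fin n} (hi : i ∈ I) (x : Fin n → ℝ) (t : ℝ) (F : ℝ → ℝ) :
    ∑ j ∈ I, F (Function.update x i t j) = F t + ∑ j ∈ I.erase i, F (x j) := by
  rw [← Finset.add_sum_erase _ _ hi, Function.update_self]
  congr 1
  exact Finset.sum_congr rfl fun j hj => by rw [Function.update_of_ne (Finset.ne_of_mem_erase hj)]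

theorem blockMean_update {i : Fin n} (hi : i ∈ I) (x : Fin n → ℝ) (t : ℝ) :
    blockMean I (Function.update x i t) = (t + ∑ j ∈ I.erase i, x j) / I.card := by
  rw [blockMean, sum_update_of_mem hi x t fun r => r]

theorem blockSS_update {i : Fin n} (hi : i ∈ I) (x : Fin n → ℝ) (t : ℝ) :
    blockSS I (Function.update x i t) = t ^ 2 + ∑ j ∈ I.erase i, x j ^ 2
      - (t + ∑ j ∈ I.erase i, x j) ^ 2 / I.card := by
  rw [blockSS_eq ⟨i, hi⟩, sum_update_of_mem hi x t fun r => r, sum_update_of_mem hi x t fun r => r ^ 2]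

theorem hasDerivAt_blockMean {i : Fin n} (hi : i ∈ I) (x : Fin n → ℝ) (t : ℝ) :
    HasDerivAt (fun r => blockMean I (Function.update x i r)) (1 / (I.card : ℝ)) t := by
  simp only [blockMean_update hi]
  exact ((hasDerivAt_id t).add_const _).div_const _

theorem hasDerivAt_blockSS {i : Fin n} (hi : i ∈ I) (x : Fin n → ℝ) (t : ℝ) :
    HasDerivAt (fun r => blockSS I (Function.update x i r))
      (2 * (t - blockMean I (Function.update x i t))) t := by
  simp only [blockSS_update hi, blockMean_update hi]
  convert! (((hasDerivAt_id t).pow 2).add_const (∑ j ∈ I.erase i, x j ^ 2)).sub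
    ((((hasDerivAt_id t).add_const (∑ j ∈ I.erase i, x j)).pow 2).div_const (I.card : ℝ)) using 1
  simp
  ring

/-- In one coordinate the sum of squares is a quadratic with leading coefficient `1 - 1/N`, nonzero
for `N ≥ 2`, so each level has at most two points. These are the possible kinks of the shrinkage
term. -/
theorem countable_blockSS_update_eq (hN : 2 ≤ I.card) {i : Fin n} (hi : i ∈ I) (x : Fin n → ℝ)
    (C : ℝ) : {t | blockSS I (Function.update x i t) = C}.Countable := by
  have hN' : (2 : ℝ) ≤ I.card := by exact_mod_cast hN
  rcases Set.eq_empty_or_nonempty {t | blockSS I (Function.update x i t) = C} with h | ⟨t₀, h₀⟩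
  · rw [h]; exact countable_empty
  -- The second point is the other root, read off from the sum of the roots.
  · refine Set.Countable.mono (s₂ := {t₀, 2 * (∑ j ∈ I.erase i, x j) / (I.card - 1) - t₀}) ?_
      ((Set.countable_singleton _).insert _)
    intro t ht
    simp only [mem_ofPred_eq, blockSS_update hi] at h₀ ht
    rw [mem_insert_iff, mem_singleton_iff]
    by_cases htt : t = t₀
    · exact Or.inl htt
    · right
      have hN1 : (I.card : ℝ) - 1 ≠ 0 := by linarith
      have hN0 : (I.card : ℝ) ≠ 0 := by linarith
      have h := ht.trans h₀.symm
      rw [eq_sub_iff_add_eq, eq_div_iff hN1]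
      field_simp at h
      refine mul_left_cancel₀ (sub_ne_zero.2 htt) ?_
      linear_combination h

/-- Away from the level `C`, continuity makes the maximum equal to one fixed argument near `t`,
leaving either a linear function or a smooth quotient. -/
theorem hasDerivAt_shrinkage {C : ℝ} (hC : 0 < C) {i : Fin n} (hi : i ∈ I) (x : Fin n → ℝ) {t : ℝ}
    (ht : blockSS I (Function.update x i t) ≠ C) :
    HasDerivAt (fun r => shrinkage I C i (Function.update x i r))
      (shrinkageDeriv I C i (Function.update x i t)) t := by
  have hS := hasDerivAt_blockSS hi x t
  have hd : HasDerivAt (fun r => r - blockMean I (Function.update x i r))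
      (1 - 1 / (I.card : ℝ)) t := (hasDerivAt_id t).sub (hasDerivAt_blockMean hi x t)
  rcases lt_or_gt_of_ne ht with h | h
  · have hev := hS.continuousAt.eventually_lt (continuousAt_const (y := C)) h
    rw [shrinkageDeriv, if_pos h.le]
    refine hd.congr_of_eventuallyEq ?_
    filter_upwards [hev] with r hr
    rw [shrinkage, max_eq_right hr.le, Function.update_self, mul_div_cancel_left₀ _ hC.ne']
  · have hev := (continuousAt_const (y := C)).eventually_lt hS.continuousAt h
    rw [shrinkageDeriv, if_neg (not_le.2 h)]
    have := (hd.const_mul C).div hS (hC.trans h).ne'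
    refine (this.congr_of_eventuallyEq ?_).congr_deriv ?_
    · filter_upwards [hev] with r hr
      rw [shrinkage, max_eq_left hr.le, Function.update_self]
      rfl
    · simp only [Function.update_self]
      ring

theorem sum_sq_shrinkage (C : ℝ) (x : Fin n → ℝ) :
    ∑ i ∈ I, shrinkage I C i x ^ 2 = C ^ 2 * blockSS I x / max (blockSS I x) C ^ 2 := by
  simp only [shrinkage, div_pow, mul_pow, ← Finset.sum_div, ← Finset.mul_sum, blockSS]

/-- The unbiased estimate of the risk difference lies below an affine function of the sum of
squares, tangent at an arbitrary point `S₀ ≥ W`. -/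
theorem sum_sq_shrinkage_sub_le {v : Fin n → ℝ} {M W C S₀ : ℝ}
    (hM : ∀ i ∈ I, v i ≤ M) (hM0 : 0 ≤ M) (hW : (1 - 1 / (I.card : ℝ)) * ∑ i ∈ I, v i = W)
    (hC : C = W - 2 * M) (hC0 : 0 < C) (hS₀ : W ≤ S₀) (x : Fin n → ℝ) :
    ∑ i ∈ I, shrinkage I C i x ^ 2 - 2 * ∑ i ∈ I, v i * shrinkageDeriv I C i x ≤
      C ^ 2 / S₀ ^ 2 * blockSS I x - 2 * C ^ 2 / S₀ := by
  have hCW : C ≤ W := by linarith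
  have hS₀0 : 0 < S₀ := by linarith
  have hS := blockSS_nonneg I x
  rw [sum_sq_shrinkage]
  rcases le_or_gt (blockSS I x) C with h | h
  · simp only [shrinkageDeriv, if_pos h, max_eq_right h, ← Finset.sum_mul]
    rw [mul_comm (∑ i ∈ I, v i), hW, mul_div_assoc, mul_comm, div_mul_cancel₀ _ (by positivity)]
    set r := C / S₀ with hr
    have hr1 : r ≤ 1 := by rw [hr, div_le_one hS₀0]; linarith
    have hr0 : 0 ≤ r := by positivity
    have e1 : C ^ 2 / S₀ ^ 2 = r ^ 2 := by rw [hr, div_pow]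
    have e2 : 2 * C ^ 2 / S₀ = 2 * C * r := by rw [hr]; ring
    rw [e1, e2]
    have : 0 ≤ 1 - r ^ 2 := by nlinarith
    -- With `S ≤ C ≤ W`, the left side is at most `S - 2C`, and `2C(1 - r) - C(1 - r²) = C(1 - r)²`.
    nlinarith [mul_le_mul_of_nonneg_right h this, mul_nonneg hC0.le (sq_nonneg (1 - r))]
  · simp only [shrinkageDeriv, if_neg (not_le.2 h), max_eq_left h.le]
    set S := blockSS I x with hSdef
    have hS0 : 0 < S := hC0.trans h
    have hD : C ^ 2 / S ≤ ∑ i ∈ I, v i * (C * ((1 - 1 / (I.card : ℝ)) * S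
        - 2 * (x i - blockMean I x) ^ 2) / S ^ 2) := by
      have e : ∑ i ∈ I, v i * (C * ((1 - 1 / (I.card : ℝ)) * S
          - 2 * (x i - blockMean I x) ^ 2) / S ^ 2)
          = C / S ^ 2 * (W * S - 2 * ∑ i ∈ I, v i * (x i - blockMean I x) ^ 2) := by
        rw [← hW, Finset.mul_sum, Finset.sum_mul, Finset.mul_sum, ← Finset.sum_sub_distrib,
          Finset.mul_sum]
        exact Finset.sum_congr rfl fun i _ => by ring
      have h2 : ∑ i ∈ I, v i * (x i - blockMean I x) ^ 2 ≤ M * S := by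
        rw [hSdef, blockSS, Finset.mul_sum]
        exact Finset.sum_le_sum fun i hi => mul_le_mul_of_nonneg_right (hM i hi) (sq_nonneg _)
      have e3 : C ^ 2 / S = C / S ^ 2 * (W * S - 2 * (M * S)) := by
        rw [hC]; field_simp
      rw [e, e3]
      gcongr
    have e4 : C ^ 2 * S / S ^ 2 = C ^ 2 / S := by field_simp
    -- This is the gap between `-C²/S` and its tangent at `S₀`.
    have h5 : 0 ≤ C ^ 2 * (S - S₀) ^ 2 / (S * S₀ ^ 2) := by positivity
    have e6 : C ^ 2 * (S - S₀) ^ 2 / (S * S₀ ^ 2)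
        = C ^ 2 / S₀ ^ 2 * S - 2 * C ^ 2 / S₀ + C ^ 2 / S := by
      field_simp; ring
    rw [e4]
    linarith

end Algebra

/-! ### Second moments under a product of normal laws -/

section Moments

variable {n : ℕ} (I : Finset (Fin n)) (θ : Fin n → ℝ) (v : Fin n → ℝ≥0)

theorem memLp_eval_pi_gaussianReal (i : Fin n) :
    MemLp (fun x : Fin n → ℝ => x i) 2 (Measure.pi fun j => gaussianReal (θ j) (v j)) :=
  (memLp_id_gaussianReal' 2 (by simp)).comp_measurePreserving
    (measurePreserving_eval (fun j => gaussianReal (θ j) (v j)) i)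

theorem integral_eval_pi_gaussianReal (i : Fin n) :
    ∫ x, x i ∂(Measure.pi fun j => gaussianReal (θ j) (v j)) = θ i := by
  have h := integral_comp_eval (μ := fun j => gaussianReal (θ j) (v j)) (i := i)
    (f := fun t : ℝ => t) continuous_id.aestronglyMeasurable
  rwa [integral_id_gaussianReal] at h

theorem variance_sum_pi_gaussianReal :
    Var[fun x => ∑ i ∈ I, x i; Measure.pi fun j => gaussianReal (θ j) (v j)] =
      ∑ i ∈ I, (v i : ℝ) := by
  have h := variance_sum_pi (μ := fun j => gaussianReal (θ j) (v j))
    -- Coordinates outside `I` are replaced by zero, so that the variance formula for the full index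
    -- set covers the partial sum.
    (X := fun i t => if i ∈ I then t else 0) (fun i => by
      by_cases hi : i ∈ I
      · simpa [hi] using! memLp_id_gaussianReal' (μ := θ i) (v := v i) 2 (by simp)
      · simp [hi])
  have e1 : (∑ i, fun ω : Fin n → ℝ => if i ∈ I then ω i else 0) = fun x => ∑ i ∈ I, x i := by
    ext x; simp [Finset.sum_apply]
  rw [e1] at h
  rw [h, ← Finset.sum_filter_add_sum_filter_not Finset.univ (· ∈ I),
    Finset.sum_eq_zero (s := Finset.univ.filter (· ∉ I)), add_zero, Finset.filter_univ_mem]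
  · exact Finset.sum_congr rfl fun i hi => by simp [hi]
  · intro i hi
    simp only [(Finset.mem_filter.1 hi).2, if_false]
    exact variance_zero _

theorem integral_sq_sum_pi_gaussianReal :
    ∫ x, (∑ i ∈ I, x i) ^ 2 ∂(Measure.pi fun j => gaussianReal (θ j) (v j)) =
      ∑ i ∈ I, (v i : ℝ) + (∑ i ∈ I, θ i) ^ 2 := by
  have hL : MemLp (fun x : Fin n → ℝ => ∑ i ∈ I, x i) 2
      (Measure.pi fun j => gaussianReal (θ j) (v j)) :=
    memLp_finsetSum I fun i _ => memLp_eval_pi_gaussianReal θ v i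
  have h := variance_eq_sub hL
  rw [variance_sum_pi_gaussianReal, integral_finsetSum _ fun i _ =>
    (memLp_eval_pi_gaussianReal θ v i).integrable one_le_two] at h
  simp only [integral_eval_pi_gaussianReal, Pi.pow_apply] at h
  linarith

theorem integral_sq_eval_pi_gaussianReal (i : Fin n) :
    ∫ x, x i ^ 2 ∂(Measure.pi fun j => gaussianReal (θ j) (v j)) = v i + θ i ^ 2 := by
  simpa using integral_sq_sum_pi_gaussianReal {i} θ v

theorem integrable_blockSS :
    Integrable (blockSS I) (Measure.pi fun j => gaussianReal (θ j) (v j)) := by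
  unfold blockSS
  refine integrable_finsetSum _ fun i _ => MemLp.integrable_sq ?_
  have : MemLp (blockMean I) 2 (Measure.pi fun j => gaussianReal (θ j) (v j)) := by
    unfold blockMean
    simp only [div_eq_inv_mul]
    exact (memLp_finsetSum I fun i _ => memLp_eval_pi_gaussianReal θ v i).const_mul _
  exact (memLp_eval_pi_gaussianReal θ v i).sub this

theorem integral_blockSS (hI : I.Nonempty) :
    ∫ x, blockSS I x ∂(Measure.pi fun j => gaussianReal (θ j) (v j)) =
      (1 - 1 / (I.card : ℝ)) * ∑ i ∈ I, (v i : ℝ) + blockSS I θ := by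
  simp only [blockSS_eq hI]
  rw [integral_sub, integral_finsetSum, integral_div, integral_sq_sum_pi_gaussianReal]
  · simp only [integral_sq_eval_pi_gaussianReal, Finset.sum_add_distrib]
    ring
  · exact fun i _ => (memLp_eval_pi_gaussianReal θ v i).integrable_sq
  · exact integrable_finsetSum _ fun i _ => (memLp_eval_pi_gaussianReal θ v i).integrable_sq
  · exact (memLp_finsetSum I fun i _ => memLp_eval_pi_gaussianReal θ v i).integrable_sq.div_const _

theorem integral_sq_sub_pi_gaussianReal (i : Fin n) :
    ∫ x, (x i - θ i) ^ 2 ∂(Measure.pi fun j => gaussianReal (θ j) (v j)) = v i := by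
  have hL := memLp_eval_pi_gaussianReal θ v i
  have h : ∀ x : Fin n → ℝ, (x i - θ i) ^ 2 = x i ^ 2 - (2 * θ i * x i - θ i ^ 2) :=
    fun x => by ring
  simp only [h]
  have h1 : Integrable (fun x : Fin n → ℝ => 2 * θ i * x i)
      (Measure.pi fun j => gaussianReal (θ j) (v j)) := (hL.integrable one_le_two).const_mul _
  have h2 : Integrable (fun x : Fin n → ℝ => 2 * θ i * x i - θ i ^ 2)
      (Measure.pi fun j => gaussianReal (θ j) (v j)) := h1.sub (integrable_const _)
  rw [integral_sub hL.integrable_sq h2, integral_sub h1 (integrable_const _), integral_const_mul, integral_eval_pi_gaussianReal,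
    integral_sq_eval_pi_gaussianReal]
  simp
  ring

end Moments

/-! ### Risk of one block -/

section Risk

variable {n : ℕ} {I : Finset (Fin n)} {θ : Fin n → ℝ} {v : Fin n → ℝ≥0}

theorem memLp_sub_shrinkage_sub {C : ℝ} (hC : 0 < C) {i : Fin n} (hi : i ∈ I) :
    MemLp (fun x => x i - shrinkage I C i x - θ i) 2
      (Measure.pi fun j => gaussianReal (θ j) (v j)) :=
  ((memLp_eval_pi_gaussianReal θ v i).sub
    (MemLp.of_bound (continuous_shrinkage hC i).aestronglyMeasurable (√C)
      (ae_of_all _ fun x => by simpa using abs_shrinkage_le hC hi x))).sub (memLp_const _)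

/-- Stein's unbiased risk estimate for `shrinkage`. -/
theorem integral_sq_sub_shrinkage {C : ℝ} (hC : 0 < C) (hN : 2 ≤ I.card) {i : Fin n} (hi : i ∈ I)
    (hv : v i ≠ 0) :
    ∫ x, (x i - shrinkage I C i x - θ i) ^ 2 ∂(Measure.pi fun j => gaussianReal (θ j) (v j)) =
      v i + ∫ x, (shrinkage I C i x ^ 2 - 2 * (v i * shrinkageDeriv I C i x))
        ∂(Measure.pi fun j => gaussianReal (θ j) (v j)) := by
  set μ := Measure.pi fun j => gaussianReal (θ j) (v j)
  have hstein := stein_pi θ v i hv (continuous_shrinkage (I := I) hC i)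
    (measurable_shrinkageDeriv C i)
    (fun x => ⟨_, countable_blockSS_update_eq hN hi x C, fun t ht =>
      hasDerivAt_shrinkage hC hi x ht⟩) (abs_shrinkage_le hC hi) (abs_shrinkageDeriv_le hC hi)
  have hL1 : MemLp (fun x : Fin n → ℝ => x i - θ i) 2 μ :=
    (memLp_eval_pi_gaussianReal θ v i).sub (memLp_const _)
  have hL2 : MemLp (shrinkage I C i) 2 μ :=
    MemLp.of_bound (continuous_shrinkage hC i).aestronglyMeasurable (√C)
      (ae_of_all _ fun x => by simpa using abs_shrinkage_le hC hi x)
  have hI3 : Integrable (shrinkageDeriv I C i) μ :=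
    Integrable.of_bound (measurable_shrinkageDeriv C i).aestronglyMeasurable 2
      (ae_of_all _ fun x => by simpa using abs_shrinkageDeriv_le hC hi x)
  have hI12 : Integrable (fun x => (x i - θ i) * shrinkage I C i x) μ := hL1.integrable_mul hL2
  have e : ∀ x : Fin n → ℝ, (x i - shrinkage I C i x - θ i) ^ 2 =
      (x i - θ i) ^ 2 - 2 * ((x i - θ i) * shrinkage I C i x) + shrinkage I C i x ^ 2 :=
    fun x => by ring
  simp only [e]
  have hI4 : Integrable (fun x => (x i - θ i) ^ 2 - 2 * ((x i - θ i) * shrinkage I C i x)) μ :=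
    hL1.integrable_sq.sub (hI12.const_mul 2)
  rw [integral_add hI4 hL2.integrable_sq,
    integral_sub hL1.integrable_sq (hI12.const_mul 2), integral_const_mul, hstein,
    integral_sq_sub_pi_gaussianReal, integral_sub hL2.integrable_sq ((hI3.const_mul _).const_mul _),
    integral_const_mul, integral_const_mul]
  ring

/-- Jensen's inequality in tangent form: the affine majorant is taken at `S₀ = W + T`, the mean of
the sum of squares, so integrating it gives exactly `-C²/(W + T)`. -/
theorem sum_integral_sq_sub_shrinkage_le {M C : ℝ} (hN : 2 ≤ I.card) (hv : ∀ i, v i ≠ 0)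
    (hM : ∀ i ∈ I, (v i : ℝ) ≤ M)
    (hC : C = (1 - 1 / (I.card : ℝ)) * ∑ i ∈ I, (v i : ℝ) - 2 * M) (hC0 : 0 < C) :
    ∑ i ∈ I, ∫ x, (x i - shrinkage I C i x - θ i) ^ 2
      ∂(Measure.pi fun j => gaussianReal (θ j) (v j)) ≤ 5 * M + blockSS I θ := by
  have hI : I.Nonempty := Finset.card_pos.1 (by omega)
  have hNpos : (0 : ℝ) < I.card := by exact_mod_cast hI.card_pos
  obtain ⟨i₀, hi₀⟩ := hI
  have hM0 : 0 ≤ M := (v i₀).2.trans (hM i₀ hi₀)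
  set μ := Measure.pi fun j => gaussianReal (θ j) (v j) with hμ
  set W := (1 - 1 / (I.card : ℝ)) * ∑ i ∈ I, (v i : ℝ) with hW
  set T := blockSS I θ with hT
  have hT0 : 0 ≤ T := blockSS_nonneg I θ
  have hmean : (∑ i ∈ I, (v i : ℝ)) / I.card ≤ M := by
    rw [div_le_iff₀ hNpos]
    calc ∑ i ∈ I, (v i : ℝ) ≤ ∑ i ∈ I, M := Finset.sum_le_sum hM
      _ = M * I.card := by simp [mul_comm]
  have hsum : ∑ i ∈ I, (v i : ℝ) = W + (∑ i ∈ I, (v i : ℝ)) / I.card := by rw [hW]; ring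
  have hI2 : ∀ i ∈ I, Integrable (fun x => shrinkage I C i x ^ 2) μ := fun i hi =>
    (MemLp.of_bound (continuous_shrinkage hC0 i).aestronglyMeasurable (√C)
      (ae_of_all _ fun x => by simpa using abs_shrinkage_le hC0 hi x) :
      MemLp (shrinkage I C i) 2 μ).integrable_sq
  have hI3 : ∀ i ∈ I, Integrable (fun x => 2 * (v i * shrinkageDeriv I C i x)) μ := fun i hi =>
    ((Integrable.of_bound (measurable_shrinkageDeriv C i).aestronglyMeasurable 2
      (ae_of_all _ fun x => by simpa using abs_shrinkageDeriv_le hC0 hi x)).const_mul _).const_mul _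
  have hbound : ∑ i ∈ I, ∫ x, (shrinkage I C i x ^ 2 - 2 * (v i * shrinkageDeriv I C i x)) ∂μ ≤
      -(C ^ 2 / (W + T)) := by
    have hI4 : ∀ i ∈ I, Integrable
        (fun x => shrinkage I C i x ^ 2 - 2 * (v i * shrinkageDeriv I C i x)) μ :=
      fun i hi => (hI2 i hi).sub (hI3 i hi)
    rw [← integral_finsetSum _ hI4]
    have hWT : 0 < W + T := by linarith
    calc _ ≤ ∫ x, (C ^ 2 / (W + T) ^ 2 * blockSS I x - 2 * C ^ 2 / (W + T)) ∂μ := by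
          refine integral_mono (integrable_finsetSum _ hI4)
            (((integrable_blockSS I θ v).const_mul _).sub (integrable_const _)) fun x => ?_
          simp only [Finset.sum_sub_distrib, ← Finset.mul_sum]
          exact sum_sq_shrinkage_sub_le hM hM0 hW.symm hC hC0 (by linarith) x
      _ = _ := by
          rw [integral_sub ((integrable_blockSS I θ v).const_mul _) (integrable_const _),
            integral_const_mul, integral_blockSS I θ v ⟨i₀, hi₀⟩, ← hW, ← hT]
          simp
          field_simp
          ring
  rw [Finset.sum_congr rfl fun i hi => integral_sq_sub_shrinkage hC0 hN hi (hv i),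
    Finset.sum_add_distrib]
  have hfin : W - C ^ 2 / (W + T) ≤ 4 * M + T := by
    have hWT : 0 < W + T := by linarith
    rw [sub_le_iff_le_add, ← sub_le_iff_le_add', le_div_iff₀ hWT, hC]
    -- After clearing the denominator the slack is `4MT + T² + 4M²`.
    nlinarith [mul_nonneg hM0 hT0, sq_nonneg M, sq_nonneg T]
  linarith

/-- The risk bound for the estimator in one block. -/
theorem sum_lintegral_block_le {u : Fin n → ℝ} (hu : ∀ i, 0 < u i) {J : Set ℝ}
    (hI : (block u J).Nonempty) :
    ∑ i ∈ block u J, ∫⁻ x, ENNReal.ofReal ((x i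
        - min 1 (cStar u J * blockMean (block u J) u / blockS2 (block u J) x) *
          (x i - blockMean (block u J) x) - θ i) ^ 2)
        ∂(Measure.pi fun j => gaussianReal (θ j) (u j).toNNReal) ≤
      ENNReal.ofReal (5 * blockMax (block u J) u + blockSS (block u J) θ) := by
  set I := block u J with hIdef
  set M := blockMax I u with hMdef
  have hM : ∀ i ∈ I, u i ≤ M := fun i hi =>
    le_ciSup (f := fun i : I => u i) (Set.finite_range _).bddAbove ⟨i, hi⟩
  have hT0 : 0 ≤ blockSS I θ := blockSS_nonneg I θ
  have hNpos : (0 : ℝ) < I.card := by exact_mod_cast hI.card_pos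
  obtain ⟨i₀, hi₀⟩ := id hI
  have hM0 : 0 ≤ M := (hu i₀).le.trans (hM i₀ hi₀)
  have hsum : ∑ i ∈ I, ((u i).toNNReal : ℝ) = ∑ i ∈ I, u i :=
    Finset.sum_congr rfl fun i _ => Real.coe_toNNReal _ (hu i).le
  have hmeanpos : 0 < blockMean I u := div_pos (Finset.sum_pos (fun i _ => hu i) hI) hNpos
  have hmean : blockMean I u ≤ M := by
    rw [blockMean, div_le_iff₀ hNpos]
    calc ∑ i ∈ I, u i ≤ ∑ i ∈ I, M := Finset.sum_le_sum hM
      _ = M * I.card := by simp [mul_comm]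
  have hWeq : (1 - 1 / (I.card : ℝ)) * ∑ i ∈ I, u i = ((I.card : ℝ) - 1) * blockMean I u := by
    rw [blockMean]; field_simp
  -- Common to the two cases without shrinkage, a single point and `C ≤ 0`: the risk is `∑ v_i = W +
  -- V̄ ≤ 4M + M`.
  have hplain : (∀ i ∈ I, ∀ x : Fin n → ℝ,
      min 1 (cStar u J * blockMean I u / blockS2 I x) * (x i - blockMean I x) = 0) →
      ((I.card : ℝ) - 1) * blockMean I u ≤ 4 * M → _ := fun h0 hle => by
    calc ∑ i ∈ I, ∫⁻ x, ENNReal.ofReal ((x i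
        - min 1 (cStar u J * blockMean I u / blockS2 I x) * (x i - blockMean I x) - θ i) ^ 2)
        ∂(Measure.pi fun j => gaussianReal (θ j) (u j).toNNReal)
        = ∑ i ∈ I, ENNReal.ofReal (u i) := by
          refine Finset.sum_congr rfl fun i hi => ?_
          simp only [h0 i hi, sub_zero]
          have hL : MemLp (fun x : Fin n → ℝ => x i - θ i) 2
              (Measure.pi fun j => gaussianReal (θ j) (u j).toNNReal) :=
            (memLp_eval_pi_gaussianReal θ _ i).sub (memLp_const (θ i))
          rw [← ofReal_integral_eq_lintegral_ofReal hL.integrable_sq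
            (ae_of_all _ fun x => sq_nonneg _),
            integral_sq_sub_pi_gaussianReal θ (fun j => (u j).toNNReal), Real.coe_toNNReal _ (hu i).le]
      _ = ENNReal.ofReal (∑ i ∈ I, u i) := (ENNReal.ofReal_sum_of_nonneg fun i _ => (hu i).le).symm
      _ ≤ ENNReal.ofReal (5 * M + blockSS I θ) := by
          refine ENNReal.ofReal_le_ofReal ?_
          have : ∑ i ∈ I, u i = ((I.card : ℝ) - 1) * blockMean I u + blockMean I u := by
            rw [blockMean]; field_simp; ring
          linarith
  rcases Nat.lt_or_ge I.card 2 with hN | hN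
  · have h1 : I.card = 1 := by have := hI.card_pos; omega
    obtain ⟨j, hj⟩ := Finset.card_eq_one.1 h1
    refine hplain (fun i hi x => ?_) (by rw [h1]; simpa using hM0)
    have : blockMean I x = x i := by
      rw [hj, Finset.mem_singleton] at hi
      simp [blockMean, hj, hi]
    rw [this, sub_self, mul_zero]
  · have hN' : (2 : ℝ) ≤ I.card := by exact_mod_cast hN
    have hN1 : (0 : ℝ) < I.card - 1 := by linarith
    have hc : cStar u J * blockMean I u * (I.card - 1) =
        max 0 (((I.card : ℝ) - 1) * blockMean I u - 2 * M) := by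
      rw [cStar, ← hIdef, ← hMdef, max_eq_left hN', mul_assoc, max_mul_of_nonneg _ _ (by positivity)]
      congr 1
      · simp
      · field_simp
    set C := ((I.card : ℝ) - 1) * blockMean I u - 2 * M with hC
    rcases le_or_gt C 0 with hC0 | hC0
    · rw [max_eq_left hC0] at hc
      refine hplain (fun i hi x => ?_) (by linarith)
      have : cStar u J * blockMean I u = 0 := by
        rcases mul_eq_zero.1 hc with h | h
        · exact h
        · linarith
      rw [this]; simp
    · rw [max_eq_right hC0.le] at hc
      have hmin : ∀ i ∈ I, ∀ x : Fin n → ℝ,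
          min 1 (cStar u J * blockMean I u / blockS2 I x) * (x i - blockMean I x) =
            shrinkage I C i x := by
        intro i hi x
        have e : cStar u J * blockMean I u / blockS2 I x = C / blockSS I x := by
          rw [blockS2, max_eq_left hN', ← blockSS, ← hc, div_div_eq_mul_div]
        rw [e, shrinkage]
        -- At `S = 0` all residuals in the block vanish, so the convention for division by zero
        -- plays no role.
        rcases (blockSS_nonneg I x).eq_or_lt with h0 | h0
        · have h2 := sq_sub_blockMean_le hi x
          rw [← h0] at h2
          have h3 : x i - blockMean I x = 0 := pow_eq_zero_iff two_ne_zero |>.1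
            (le_antisymm h2 (sq_nonneg _))
          simp [h3]
        · rcases le_total (blockSS I x) C with h | h
          · rw [min_eq_left ((one_le_div h0).2 h), max_eq_right h]
            field_simp
          · rw [min_eq_right ((div_le_one h0).2 h), max_eq_left h]
            ring
      have hv : ∀ i, (u i).toNNReal ≠ 0 := fun i => by simpa using hu i
      calc _ = ∑ i ∈ I, ENNReal.ofReal (∫ x, (x i - shrinkage I C i x - θ i) ^ 2
              ∂(Measure.pi fun j => gaussianReal (θ j) (u j).toNNReal)) := by
            refine Finset.sum_congr rfl fun i hi => ?_
            simp only [hmin i hi]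
            rw [ofReal_integral_eq_lintegral_ofReal (memLp_sub_shrinkage_sub hC0 hi).integrable_sq
              (ae_of_all _ fun x => sq_nonneg _)]
        _ = ENNReal.ofReal (∑ i ∈ I, ∫ x, (x i - shrinkage I C i x - θ i) ^ 2
              ∂(Measure.pi fun j => gaussianReal (θ j) (u j).toNNReal)) :=
            (ENNReal.ofReal_sum_of_nonneg fun i _ => integral_nonneg fun x => sq_nonneg _).symm
        _ ≤ _ := by
            refine ENNReal.ofReal_le_ofReal (sum_integral_sq_sub_shrinkage_le hN hv
              (fun i hi => by rw [Real.coe_toNNReal _ (hu i).le]; exact hM i hi) ?_ hC0)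
            rw [hsum, hWeq]

end Risk

/-! ### Counting bins and splitting sums over them -/

section Binning

variable {n m : ℕ}

theorem mem_block {v : Fin n → ℝ} {J : Set ℝ} {i : Fin n} : i ∈ block v J ↔ v i ∈ J := by
  simp [block]

theorem le_vMax (v : Fin n → ℝ) (i : Fin n) : v i ≤ vMax v :=
  le_ciSup (Set.finite_range v).bddAbove i

theorem blockMax_le_vMax {I : Finset (Fin n)} (hI : I.Nonempty) (v : Fin n → ℝ) :
    blockMax I v ≤ vMax v :=
  have : Nonempty I := hI.to_subtype
  ciSup_le fun i => le_vMax v i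

theorem vMax_pos (hn : 0 < n) {v : Fin n → ℝ} (hv : ∀ i, 0 < v i) : 0 < vMax v :=
  (hv ⟨0, hn⟩).trans_le (le_vMax v _)

theorem abs_sub_le_of_volume_eq {J : Set ℝ} (hJ : J.OrdConnected) {w : ℝ} (hw : 0 ≤ w)
    (hJw : volume J = ENNReal.ofReal w) {s t : ℝ} (hs : s ∈ J) (ht : t ∈ J) : |s - t| ≤ w := by
  have key : ∀ s ∈ J, ∀ t ∈ J, t - s ≤ w := by
    intro s hs t ht
    have h := measure_mono (μ := volume) (hJ.out hs ht)
    rw [Real.volume_Icc, hJw] at h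
    exact (ENNReal.ofReal_le_ofReal_iff hw).1 h
  rw [abs_le]
  constructor <;> linarith [key s hs t ht, key t ht s hs]

/-- The dispersion of a block is controlled by the squared differences. -/
theorem blockSS_le {I : Finset (Fin n)} (hI : I.Nonempty) {x : Fin n → ℝ} {B : ℝ}
    (hB : ∀ i ∈ I, ∀ j ∈ I, (x i - x j) ^ 2 ≤ B) : blockSS I x ≤ I.card * (B / 2) := by
  have hN : (0 : ℝ) < I.card := by exact_mod_cast hI.card_pos
  have h1 : ∑ i ∈ I, ∑ j ∈ I, (x i - x j) ^ 2 ≤ I.card * (I.card * B) := by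
    calc _ ≤ ∑ i ∈ I, ∑ j ∈ I, B :=
          Finset.sum_le_sum fun i hi => Finset.sum_le_sum fun j hj => hB i hi j hj
      _ = _ := by simp
  -- Lagrange's identity; its factor 2 is the source of `B / 2`.
  have h2 : ∑ i ∈ I, ∑ j ∈ I, (x i - x j) ^ 2 = 2 * I.card * blockSS I x := by
    rw [blockSS_eq hI]
    simp only [sub_sq, Finset.sum_add_distrib, Finset.sum_sub_distrib, Finset.sum_const,
      nsmul_eq_mul, ← Finset.sum_mul, ← Finset.mul_sum]
    field_simp
    ring
  rw [h2] at h1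
  have := le_of_mul_le_mul_left (a := (I.card : ℝ))
    (b := 2 * blockSS I x) (c := I.card * B) (by linarith) hN
  linarith

theorem card_filter_mem_le_one {J : Fin m → Set ℝ}
    (hJ : Pairwise fun k l => Disjoint (J k) (J l)) (K : Finset (Fin m)) (t : ℝ)
    [DecidablePred fun k => t ∈ J k] : (K.filter fun k => t ∈ J k).card ≤ 1 := by
  refine Finset.card_le_one.2 fun k hk l hl => by_contra fun hkl => ?_
  exact Set.disjoint_left.1 (hJ hkl) (Finset.mem_filter.1 hk).2 (Finset.mem_filter.1 hl).2

/-- At most `2 + T / w` disjoint intervals of length `w` meet `[0, T]`. -/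
theorem card_mul_le_of_disjoint {J : Fin m → Set ℝ} {w T : ℝ} (hw : 0 ≤ w) (hT : 0 ≤ T)
    (hord : ∀ k, (J k).OrdConnected) (hlen : ∀ k, volume (J k) = ENNReal.ofReal w)
    (hdisj : Pairwise fun k l => Disjoint (J k) (J l)) (K : Finset (Fin m))
    (hK : ∀ k ∈ K, (J k ∩ Icc 0 T).Nonempty) : (K.card : ℝ) * w ≤ T + 2 * w := by
  classical
  set K₀ := K.filter fun k => J k ⊆ Icc 0 T
  -- An interval that meets `[0, T]` without lying inside it contains an endpoint. By disjointness
  -- each endpoint accounts for at most one bin; the remaining bins are counted by volume.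
  have hsub : K ⊆ K₀ ∪ ((K.filter fun k => (0 : ℝ) ∈ J k) ∪ K.filter fun k => T ∈ J k) := by
    intro k hk
    simp only [Finset.mem_union, Finset.mem_filter, K₀]
    by_cases h : J k ⊆ Icc 0 T
    · exact Or.inl ⟨hk, h⟩
    · right
      obtain ⟨s, hs, hs'⟩ := Set.not_subset.1 h
      obtain ⟨t, ht, ht0, htT⟩ := hK k hk
      rcases lt_or_ge s 0 with h0 | h0
      · exact Or.inl ⟨hk, (hord k).out hs ht ⟨h0.le, ht0⟩⟩
      · refine Or.inr ⟨hk, (hord k).out ht hs ⟨htT, ?_⟩⟩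
        by_contra hsT
        exact hs' ⟨h0, (not_le.1 hsT).le⟩
  have hcard : K.card ≤ K₀.card + 2 := by
    have h1 := card_filter_mem_le_one hdisj K 0
    have h2 := card_filter_mem_le_one hdisj K T
    have h3 := Finset.card_le_card hsub
    have h4 := Finset.card_union_le K₀
      ((K.filter fun k => (0 : ℝ) ∈ J k) ∪ K.filter fun k => T ∈ J k)
    have h5 := Finset.card_union_le (K.filter fun k => (0 : ℝ) ∈ J k) (K.filter fun k => T ∈ J k)
    omega
  have hvol : (K₀.card : ℝ) * w ≤ T := by
    have h : volume (⋃ k ∈ K₀, J k) ≤ volume (Icc 0 T) :=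
      measure_mono (Set.iUnion₂_subset fun k hk => (Finset.mem_filter.1 hk).2)
    rw [measure_biUnion_finset (fun k _ l _ hkl => hdisj hkl)
      (fun k _ => (hord k).measurableSet), Real.volume_Icc] at h
    simp only [hlen, Finset.sum_const, nsmul_eq_mul, sub_zero] at h
    rw [← ENNReal.ofReal_natCast, ← ENNReal.ofReal_mul (by positivity),
      ENNReal.ofReal_le_ofReal_iff hT] at h
    exact h
  have : (K.card : ℝ) ≤ K₀.card + 2 := by exact_mod_cast hcard
  nlinarith

theorem groupLinear_of_mem {J : Fin m → Set ℝ} (hJ : Pairwise fun k l => Disjoint (J k) (J l))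
    (c : Fin m → ℝ) {v : Fin n → ℝ} {i : Fin n} {k : Fin m} (hi : v i ∈ J k) (x : Fin n → ℝ) :
    groupLinear J c v x i = x i -
      min 1 (c k * blockMean (block v (J k)) v / blockS2 (block v (J k)) x) *
        (x i - blockMean (block v (J k)) x) := by
  classical
  rw [groupLinear, Finset.sum_eq_single k]
  · intro l hl hlk
    exact absurd hi (Set.disjoint_left.1 (hJ hlk) (Finset.mem_filter.1 hl).2)
  · intro h
    simp [hi] at h

theorem sum_eq_sum_block {β : Type*} [AddCommMonoid β] {J : Fin m → Set ℝ} {w : ℝ} {v : Fin n → ℝ}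
    (hJ : IsEqualBinning J w v) (g : Fin n → β) :
    ∑ i, g i = ∑ k, ∑ i ∈ block v (J k), g i := by
  classical
  choose κ hκ using hJ.cover
  rw [← Finset.sum_fiberwise Finset.univ κ g]
  refine Finset.sum_congr rfl fun k _ => Finset.sum_congr ?_ fun _ _ => rfl
  ext i
  simp only [Finset.mem_filter, Finset.mem_univ, true_and, mem_block]
  refine ⟨fun h => h ▸ hκ i, fun h => by_contra fun hne => ?_⟩
  exact Set.disjoint_left.1 (hJ.disjoint hne) (hκ i) h

end Binning

/-! ### The bin width and the rate -/

section Width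

variable {n : ℕ}

theorem binWidth_pos (hn : 0 < n) {L : ℝ} (hL : 0 < L) {v : Fin n → ℝ} (hv : 0 < vMax v) :
    0 < binWidth L v := by
  have : (0 : ℝ) < n := by exact_mod_cast hn
  unfold binWidth
  positivity

theorem binWidth_cube (hn : 0 < n) {L : ℝ} (hL : 0 < L) (v : Fin n → ℝ) :
    binWidth L v ^ 3 = 10 * vMax v ^ 2 / (n * L) := by
  have : (0 : ℝ) < n := by exact_mod_cast hn
  rw [binWidth, ← Real.rpow_natCast, ← Real.rpow_mul (by positivity)]
  norm_num

/-- The base is the cube of `√L w`, since `w³` carries `1/L` and `√L ^ 3 / L = √L`. -/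
theorem rate_eq (hn : 0 < n) {L : ℝ} (hL : 0 < L) {v : Fin n → ℝ} (hv : 0 < vMax v) :
    (10 * vMax v ^ 2 * √L / n) ^ (2 / 3 : ℝ) = L * binWidth L v ^ 2 := by
  have hn' : (0 : ℝ) < n := by exact_mod_cast hn
  have hw := binWidth_pos hn hL hv
  have hsq : √L ^ 2 = L := Real.sq_sqrt hL.le
  have h : 10 * vMax v ^ 2 * √L / n = (√L * binWidth L v) ^ (3 : ℕ) := by
    rw [mul_pow, binWidth_cube hn hL, show √L ^ 3 = √L * √L ^ 2 by ring, hsq]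
    field_simp
  have hpos : 0 ≤ √L * binWidth L v := by positivity
  rw [h, ← Real.rpow_natCast, ← Real.rpow_mul hpos,
    show ((3 : ℕ) : ℝ) * (2 / 3 : ℝ) = ((2 : ℕ) : ℝ) by norm_num, Real.rpow_natCast, mul_pow, hsq]

end Width

/-! ### The bound for fixed variances -/

/-- The risk bound in the regression model with fixed variances. -/
theorem groupLinearRisk_regressionLaw_le {a : ℝ → ℝ} {L : ℝ≥0} (hL : 0 < L)
    (haL : LipschitzOnWith (NNReal.sqrt L) a (Ioi 0)) {n m : ℕ} (hn : 0 < n) {v : Fin n → ℝ}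
    (hv : ∀ i, 0 < v i) {J : Fin m → Set ℝ} (hw : binWidth L v ≤ vMax v)
    (hJ : IsEqualBinning J (binWidth L v) v) :
    groupLinearRisk J v (regressionLaw a v) ≤
      ENNReal.ofReal (2 * (10 * vMax v ^ 2 * √L / n) ^ (2 / 3 : ℝ)) := by
  classical
  have hL' : (0 : ℝ) < L := by exact_mod_cast hL
  have hn' : (0 : ℝ) < n := by exact_mod_cast hn
  have hV := vMax_pos hn hv
  have hw0 := binWidth_pos hn hL' hV
  rw [rate_eq hn hL' hV]
  set w := binWidth L v with hwdef
  set θ : Fin n → ℝ := fun i => a (v i) with hθ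
  set K := Finset.univ.filter fun k => (block v (J k)).Nonempty with hK
  have hKcard : (K.card : ℝ) * w ≤ 3 * vMax v := by
    have := card_mul_le_of_disjoint hw0.le hV.le hJ.interval hJ.length hJ.disjoint K
      fun k hk => by
        obtain ⟨i, hi⟩ := (Finset.mem_filter.1 hk).2
        exact ⟨v i, mem_block.1 hi, (hv i).le, le_vMax v i⟩
    linarith
  have hSS : ∀ k ∈ K, blockSS (block v (J k)) θ ≤ (block v (J k)).card * (L * w ^ 2 / 2) := by
    intro k hk
    refine blockSS_le (Finset.mem_filter.1 hk).2 fun i hi j hj => ?_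
    have h1 := haL.dist_le_mul (v i) (hv i) (v j) (hv j)
    have h2 := abs_sub_le_of_volume_eq (hJ.interval k) hw0.le (hJ.length k) (mem_block.1 hi)
      (mem_block.1 hj)
    rw [Real.dist_eq, Real.dist_eq, Real.coe_sqrt] at h1
    have h3 : |a (v i) - a (v j)| ≤ √L * w :=
      h1.trans (mul_le_mul_of_nonneg_left h2 (Real.sqrt_nonneg _))
    calc (θ i - θ j) ^ 2 = |a (v i) - a (v j)| ^ 2 := (sq_abs _).symm
      _ ≤ (√L * w) ^ 2 := by gcongr
      _ = L * w ^ 2 := by rw [mul_pow, Real.sq_sqrt hL'.le]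
  have hcount : ∑ k, ((block v (J k)).card : ℝ) = n := by
    have := sum_eq_sum_block hJ fun _ => (1 : ℝ)
    simpa using this.symm
  have hblock : ∀ k, ∑ i ∈ block v (J k), ∫⁻ z,
      ENNReal.ofReal ((groupLinear J (fun k => cStar v (J k)) v z.1 i - z.2 i) ^ 2)
        ∂(regressionLaw a v) ≤
      ENNReal.ofReal (if k ∈ K then 5 * vMax v + (block v (J k)).card * (L * w ^ 2 / 2) else 0) := by
    intro k
    by_cases hk : k ∈ K
    · have hne := (Finset.mem_filter.1 hk).2
      rw [if_pos hk]
      calc _ ≤ ∑ i ∈ block v (J k), ∫⁻ x, ENNReal.ofReal ((x i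
            - min 1 (cStar v (J k) * blockMean (block v (J k)) v / blockS2 (block v (J k)) x) *
              (x i - blockMean (block v (J k)) x) - θ i) ^ 2)
            ∂(Measure.pi fun j => gaussianReal (θ j) (v j).toNNReal) := by
            refine Finset.sum_le_sum fun i hi => ?_
            -- Only this direction is needed, and it requires no measurability of the estimator.
            refine (lintegral_map_le _ _).trans (le_of_eq ?_)
            refine lintegral_congr fun x => ?_
            rw [groupLinear_of_mem hJ.disjoint _ (mem_block.1 hi)]
        _ ≤ _ := sum_lintegral_block_le hv hne
        _ ≤ _ := by
            refine ENNReal.ofReal_le_ofReal ?_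
            linarith [hSS k hk, blockMax_le_vMax hne v]
    · have : block v (J k) = ∅ := by
        simpa [hK, Finset.not_nonempty_iff_eq_empty] using hk
      simp [this]
  have hreal : ∑ k, (if k ∈ K then 5 * vMax v + (block v (J k)).card * (L * w ^ 2 / 2) else 0) ≤
      n * (2 * (L * w ^ 2)) := by
    have h1 : ∑ k, (if k ∈ K then 5 * vMax v + (block v (J k)).card * (L * w ^ 2 / 2) else 0) ≤
        K.card * (5 * vMax v) + n * (L * w ^ 2 / 2) := by
      rw [Finset.sum_ite_mem, Finset.univ_inter, Finset.sum_add_distrib, Finset.sum_const,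
        nsmul_eq_mul, ← hcount, Finset.sum_mul]
      gcongr
      exact Finset.subset_univ K
    have hcube : w ^ 3 * (n * L) = 10 * vMax v ^ 2 := by
      rw [hwdef, binWidth_cube hn hL']
      field_simp
    have h2 : K.card * (5 * vMax v) ≤ n * (3 / 2 * (L * w ^ 2)) := by
      refine le_of_mul_le_mul_right ?_ hw0
      calc K.card * (5 * vMax v) * w = (K.card * w) * (5 * vMax v) := by ring
        _ ≤ 3 * vMax v * (5 * vMax v) := by gcongr
        _ = 3 / 2 * (10 * vMax v ^ 2) := by ring
        _ = _ := by rw [← hcube]; ring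
    linarith
  have hnn : ∀ k ∈ (Finset.univ : Finset (Fin m)),
      0 ≤ (if k ∈ K then 5 * vMax v + (block v (J k)).card * (L * w ^ 2 / 2) else 0) := by
    intro k _
    split_ifs <;> positivity
  rw [groupLinearRisk, sum_eq_sum_block hJ]
  calc _ ≤ (n : ℝ≥0∞)⁻¹ * ∑ k, ENNReal.ofReal
          (if k ∈ K then 5 * vMax v + (block v (J k)).card * (L * w ^ 2 / 2) else 0) :=
        mul_le_mul_right (Finset.sum_le_sum fun k _ => hblock k) _
    _ ≤ (n : ℝ≥0∞)⁻¹ * ENNReal.ofReal (n * (2 * (L * w ^ 2))) := by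
        rw [← ENNReal.ofReal_sum_of_nonneg hnn]
        exact mul_le_mul_right (ENNReal.ofReal_le_ofReal hreal) _
    _ = _ := by
        rw [ENNReal.ofReal_mul hn'.le, ENNReal.ofReal_natCast, ← mul_assoc,
          ENNReal.inv_mul_cancel (by exact_mod_cast hn.ne') (ENNReal.natCast_ne_top n), one_mul]

/-! ### From the population to the fixed-variance model -/

/-- Driving all normal laws by one standard noise makes them depend measurably on mean and variance.
For `s ≤ 0` both sides are the point mass at `m`, so no sign condition is needed. -/
theorem gaussianReal_eq_map_standard (m s : ℝ) :
    gaussianReal m s.toNNReal = (gaussianReal 0 1).map fun z => m + √s * z := by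
  have h : (fun z : ℝ => m + √s * z) = (fun y => m + y) ∘ fun z => √s * z := rfl
  rw [h, ← Measure.map_map (by fun_prop) (by fun_prop), gaussianReal_map_const_mul,
    gaussianReal_map_const_add]
  congr 1
  · simp
  · ext
    simp only [NNReal.coe_mk, mul_one]
    rcases le_total 0 s with h | h
    · rw [Real.sq_sqrt h, Real.coe_toNNReal _ h]
    · rw [Real.sqrt_eq_zero_of_nonpos h, Real.toNNReal_of_nonpos h]; simp

section Population

variable (Q : Measure (ℝ × ℝ × ℝ)) [IsProbabilityMeasure Q]

instance : IsProbabilityMeasure (varLaw Q) :=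
  Measure.isProbabilityMeasure_map (by fun_prop)

instance : IsMarkovKernel (condYgivenA Q) := by
  unfold condYgivenA; infer_instance

theorem measurable_oracleA : Measurable (oracleA Q) := by
  have h : StronglyMeasurable fun p : ℝ × ℝ => p.2 := measurable_snd.stronglyMeasurable
  exact (h.integral_kernel_prod_right' (κ := condYgivenA Q)).measurable

theorem measurable_oracleB : Measurable (oracleB Q) := by
  unfold oracleB variance evariance
  refine measurable_id.div (Measurable.ennreal_toReal ?_)
  refine Measurable.lintegral_kernel_prod_right' (κ := condYgivenA Q)
    (f := fun p : ℝ × ℝ => ‖p.2 - ∫ y, y ∂(condYgivenA Q p.1)‖ₑ ^ 2) ?_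
  exact ((measurable_snd.sub ((measurable_oracleA Q).comp measurable_fst)).enorm).pow_const 2

variable {Q}

/-- If the oracle risk vanishes then `ξ = a*(A)` almost surely. -/
theorem ae_eq_oracleA (hQ : IsNormalPopulation Q)
    (hr : bayesRisk Q (oracleA Q) (oracleB Q) = 0) : ∀ᵐ t ∂Q, t.2.1 = oracleA Q t.2.2 := by
  have hA := measurable_oracleA Q
  have hB := measurable_oracleB Q
  have h1 : ∀ᵐ t ∂Q, t.1 - oracleB Q t.2.2 * (t.1 - oracleA Q t.2.2) - t.2.1 = 0 := by
    rw [bayesRisk, lintegral_eq_zero_iff (by fun_prop)] at hr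
    filter_upwards [hr] with t ht
    simpa [sq_nonpos_iff] using ht
  have h2 : ∀ᵐ p ∂((Q.map Prod.snd) ⊗ₘ condDistrib Prod.fst Prod.snd Q),
      p.2 - oracleB Q p.1.2 * (p.2 - oracleA Q p.1.2) - p.1.1 = 0 := by
    rw [compProd_map_condDistrib (by fun_prop), ae_map_iff (by fun_prop)
      (measurableSet_eq_fun (by fun_prop) (by fun_prop))]
    exact h1
  have h3 := Measure.ae_ae_of_ae_compProd h2
  have h4 : ∀ᵐ p ∂(Q.map Prod.snd), 0 < p.2 := by
    rw [ae_map_iff (by fun_prop) (measurableSet_lt (by fun_prop) (by fun_prop))]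
    exact hQ.var_pos
  refine ae_of_ae_map (f := Prod.snd) (p := fun p : ℝ × ℝ => p.1 = oracleA Q p.2) (by fun_prop) ?_
  filter_upwards [h3, h4, hQ.cond_normal] with p hp hpos hlaw
  rw [hlaw] at hp
  have hv : p.2.toNNReal ≠ 0 := by simpa using hpos
  have := nullSingletonClass_gaussianReal (μ := p.1) hv
  have hb : oracleB Q p.2 = 1 := by
    by_contra hb
    have hb' : 1 - oracleB Q p.2 ≠ 0 := sub_ne_zero.2 (Ne.symm hb)
    -- If the slope `1 - b*` were nonzero, the affine function would vanish only at `c`, a null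
    -- point for a nondegenerate normal law.
    set c := (p.1 - oracleB Q p.2 * oracleA Q p.2) / (1 - oracleB Q p.2) with hc
    have hne : ∀ᵐ y ∂(gaussianReal p.1 p.2.toNNReal), y ≠ c := by
      simp [ae_iff]
    obtain ⟨y, hy1, hy2⟩ := (hp.and hne).exists
    refine hy2 ?_
    rw [hc, eq_div_iff hb']
    linear_combination hy1
  obtain ⟨y, hy⟩ := hp.exists
  rw [hb] at hy
  linarith

/-- If the oracle risk vanishes then `(Y, ξ, A)` is distributed as `(a*(A) + √A Z, a*(A), A)` with
`Z` standard normal and independent of `A`. -/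
theorem eq_map_varLaw_prod (hQ : IsNormalPopulation Q)
    (hr : bayesRisk Q (oracleA Q) (oracleB Q) = 0) :
    Q = ((varLaw Q).prod (gaussianReal 0 1)).map
      fun p => (oracleA Q p.1 + √p.1 * p.2, oracleA Q p.1, p.1) := by
  have hA := measurable_oracleA Q
  have hG : Measurable fun p : ℝ × ℝ => (oracleA Q p.1 + √p.1 * p.2, oracleA Q p.1, p.1) := by
    fun_prop
  have hsnd : Q.map Prod.snd = (varLaw Q).map fun s => (oracleA Q s, s) := by
    rw [varLaw, Measure.map_map (by fun_prop) (by fun_prop)]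
    refine Measure.map_congr ?_
    filter_upwards [ae_eq_oracleA hQ hr] with t ht
    exact Prod.ext ht rfl
  ext E hE
  have hsw : MeasurableSet {p : (ℝ × ℝ) × ℝ | (p.2, p.1) ∈ E} := by
    have : Measurable fun p : (ℝ × ℝ) × ℝ => (p.2, p.1) := by fun_prop
    exact this hE
  have h1 : Q E = (Q.map fun t : ℝ × ℝ × ℝ => (t.2, t.1)) {p | (p.2, p.1) ∈ E} := by
    rw [Measure.map_apply (by fun_prop) hsw]
    rfl
  rw [h1, ← compProd_map_condDistrib (by fun_prop), Measure.compProd_apply hsw,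
    Measure.map_apply hG hE, Measure.prod_apply (hG hE)]
  have h2 : ∫⁻ p, condDistrib Prod.fst Prod.snd Q p (Prod.mk p ⁻¹' {p | (p.2, p.1) ∈ E})
      ∂(Q.map Prod.snd) = ∫⁻ p, (gaussianReal 0 1) {z | (p.1 + √p.2 * z, p) ∈ E}
        ∂(Q.map Prod.snd) := by
    refine lintegral_congr_ae ?_
    filter_upwards [hQ.cond_normal] with p hp
    rw [hp, gaussianReal_eq_map_standard, Measure.map_apply (by fun_prop)
      (measurable_prodMk_left hsw)]
    rfl
  rw [h2, hsnd, lintegral_map _ (by fun_prop)]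
  · rfl
  · have hE' : MeasurableSet {q : (ℝ × ℝ) × ℝ | (q.1.1 + √q.1.2 * q.2, q.1) ∈ E} := by
      have : Measurable fun q : (ℝ × ℝ) × ℝ => (q.1.1 + √q.1.2 * q.2, q.1) := by fun_prop
      exact this hE
    exact measurable_measure_prodMk_left hE'

end Population

theorem regressionLaw_eq_map {n : ℕ} (a : ℝ → ℝ) (v : Fin n → ℝ) :
    regressionLaw a v = (Measure.pi fun _ : Fin n => gaussianReal 0 1).map
      fun z => ((fun i => a (v i) + √(v i) * z i), fun i => a (v i)) := by
  rw [regressionLaw]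
  simp only [gaussianReal_eq_map_standard]
  rw [← Measure.pi_map_pi fun i => by fun_prop, Measure.map_map (by fun_prop) (by fun_prop)]
  rfl

/-- In the sample, the conditional law of `(X, θ)` given `V = v` is that of the regression model. -/
theorem condDistrib_ae_eq_regressionLaw {Ω : Type*} [MeasurableSpace Ω] {P : Measure Ω}
    [IsProbabilityMeasure P] {Q : Measure (ℝ × ℝ × ℝ)} [IsProbabilityMeasure Q]
    (hQ : IsNormalPopulation Q) (hr : bayesRisk Q (oracleA Q) (oracleB Q) = 0)
    {n : ℕ} {X θ V : Fin n → Ω → ℝ} (hX : ∀ i, Measurable (X i)) (hθ : ∀ i, Measurable (θ i))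
    (hV : ∀ i, Measurable (V i)) (hindep : iIndepFun (fun i ω => (X i ω, θ i ω, V i ω)) P)
    (hlaw : ∀ i, P.map (fun ω => (X i ω, θ i ω, V i ω)) = Q) :
    P.map (fun ω i => V i ω) = Measure.pi (fun _ => varLaw Q) ∧
    ∀ᵐ v ∂(P.map fun ω i => V i ω),
      condDistrib (fun ω => ((fun i => X i ω), (fun i => θ i ω))) (fun ω i => V i ω) P v =
        regressionLaw (oracleA Q) v := by
  have hA := measurable_oracleA Q
  set γ : Measure (Fin n → ℝ) := Measure.pi fun _ => gaussianReal 0 1 with hγ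
  set ρ : Measure (Fin n → ℝ) := Measure.pi fun _ => varLaw Q with hρ
  set G : (Fin n → ℝ) × (Fin n → ℝ) → (Fin n → ℝ) × (Fin n → ℝ) := fun p =>
    ((fun i => oracleA Q (p.1 i) + √(p.1 i) * p.2 i), fun i => oracleA Q (p.1 i)) with hG
  have hGm : Measurable G := by fun_prop
  have hsample : P.map (fun ω i => (X i ω, θ i ω, V i ω)) =
      (ρ.prod γ).map fun p i => (oracleA Q (p.1 i) + √(p.1 i) * p.2 i, oracleA Q (p.1 i), p.1 i) := by
    rw [(iIndepFun_iff_map_fun_eq_pi_map fun i => by fun_prop).1 hindep]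
    simp only [hlaw]
    have h1 := (measurePreserving_arrowProdEquivProdArrow ℝ ℝ (Fin n) (fun _ => varLaw Q)
      (fun _ => gaussianReal 0 1)).map_eq
    have h2 := Measure.pi_map_pi (μ := fun _ : Fin n => (varLaw Q).prod (gaussianReal 0 1))
      (f := fun _ p => (oracleA Q p.1 + √p.1 * p.2, oracleA Q p.1, p.1))
      (fun i => by fun_prop)
    rw [← eq_map_varLaw_prod hQ hr] at h2
    rw [← h2, hρ, hγ, ← h1, Measure.map_map (by fun_prop) (by fun_prop)]
    rfl
  have hjoint : P.map (fun ω => ((fun i => V i ω), ((fun i => X i ω), fun i => θ i ω))) =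
      (ρ.prod γ).map fun p => (p.1, G p) := by
    have hH : Measurable fun q : Fin n → ℝ × ℝ × ℝ =>
        ((fun i => (q i).2.2), ((fun i => (q i).1), fun i => (q i).2.1)) := by fun_prop
    have := congrArg (fun μ => μ.map fun q : Fin n → ℝ × ℝ × ℝ =>
        ((fun i => (q i).2.2), ((fun i => (q i).1), fun i => (q i).2.1))) hsample
    rw [Measure.map_map hH (by fun_prop), Measure.map_map hH (by fun_prop)] at this
    exact this
  have hVlaw : P.map (fun ω i => V i ω) = ρ := by
    have := congrArg (fun μ => μ.map Prod.fst) hjoint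
    rw [Measure.map_map (by fun_prop) (by fun_prop), Measure.map_map (by fun_prop) (by fun_prop)]
      at this
    refine this.trans ?_
    exact Measure.map_fst_prod.trans (by simp)
  refine ⟨hVlaw, ?_⟩
  -- The candidate conditional law: keep `v`, draw independent noise, apply `G`. Almost everywhere
  -- uniqueness of disintegrations then identifies it with `condDistrib`.
  set κ : Kernel (Fin n → ℝ) ((Fin n → ℝ) × (Fin n → ℝ)) :=
    (Kernel.id ×ₖ Kernel.const _ γ).map G with hκ
  have hκv : ∀ v, κ v = γ.map fun z => G (v, z) := by
    intro v
    rw [hκ, Kernel.map_apply _ hGm, Kernel.prod_apply, Kernel.id_apply, Kernel.const_apply,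
      Measure.dirac_prod, Measure.map_map hGm (by fun_prop)]
    rfl
  have : IsMarkovKernel κ := Kernel.IsMarkovKernel.map _ hGm
  have hcomp : P.map (fun ω => ((fun i => V i ω), ((fun i => X i ω), fun i => θ i ω))) =
      P.map (fun ω i => V i ω) ⊗ₘ κ := by
    rw [hjoint, hVlaw]
    ext E hE
    have hm : Measurable fun p : (Fin n → ℝ) × (Fin n → ℝ) => (p.1, G p) := by fun_prop
    rw [Measure.map_apply hm hE, Measure.prod_apply (hm hE), Measure.compProd_apply hE]
    refine lintegral_congr fun v => ?_
    rw [hκv, Measure.map_apply (by fun_prop) (measurable_prodMk_left hE)]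
    rfl
  have := condDistrib_ae_eq_of_measure_eq_compProd (fun ω i => V i ω) (by fun_prop) hcomp
  filter_upwards [this] with v hv
  rw [hv, hκv, regressionLaw_eq_map]

end GroupLinear

theorem theorem2
    {Ω : Type*} [MeasurableSpace Ω] (P : Measure Ω) [IsProbabilityMeasure P]
    -- the population, with `r(a*, b*) = 0`
    (Q : Measure (ℝ × ℝ × ℝ)) [IsProbabilityMeasure Q]
    (hQ : GroupLinear.IsNormalPopulation Q)
    (hr : GroupLinear.bayesRisk Q (GroupLinear.oracleA Q) (GroupLinear.oracleB Q) = 0)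
    -- `a` is a Lipschitz version of `a*`
    (a : ℝ → ℝ) (ha : a =ᵐ[GroupLinear.varLaw Q] GroupLinear.oracleA Q)
    (L : ℝ≥0) (hL : 0 < L) (haL : LipschitzOnWith (NNReal.sqrt L) a (Ioi 0))
    -- an i.i.d. sample from the population
    (n : ℕ) (hn : 0 < n) (X θ V : Fin n → Ω → ℝ)
    (hX : ∀ i, Measurable (X i)) (hθ : ∀ i, Measurable (θ i)) (hV : ∀ i, Measurable (V i))
    (hindep : iIndepFun (fun i ω => (X i ω, θ i ω, V i ω)) P)
    (hlaw : ∀ i, P.map (fun ω => (X i ω, θ i ω, V i ω)) = Q) :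
    -- conditionally on `V = v`, for almost every `v`
    (∀ᵐ v ∂(P.map fun ω i => V i ω), ∀ (m : ℕ) (J : Fin m → Set ℝ),
      GroupLinear.binWidth L v ≤ GroupLinear.vMax v →
      GroupLinear.IsEqualBinning J (GroupLinear.binWidth L v) v →
      GroupLinear.groupLinearRisk J v
          (condDistrib (fun ω => ((fun i => X i ω), (fun i => θ i ω))) (fun ω i => V i ω) P v) ≤
        ENNReal.ofReal
          (2 * (10 * GroupLinear.vMax v ^ 2 * Real.sqrt L / n) ^ (2 / 3 : ℝ))) ∧
    -- for every deterministic `v`, with `X_i ∼ N(a*(v_i), v_i)` independent and `θ_i = a*(v_i)`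
    (∀ v : Fin n → ℝ, (∀ i, 0 < v i) → ∀ (m : ℕ) (J : Fin m → Set ℝ),
      GroupLinear.binWidth L v ≤ GroupLinear.vMax v →
      GroupLinear.IsEqualBinning J (GroupLinear.binWidth L v) v →
      GroupLinear.groupLinearRisk J v (GroupLinear.regressionLaw a v) ≤
        ENNReal.ofReal
          (2 * (10 * GroupLinear.vMax v ^ 2 * Real.sqrt L / n) ^ (2 / 3 : ℝ))) := by
  refine ⟨?_, fun v hv m J hw hJ =>
    GroupLinear.groupLinearRisk_regressionLaw_le hL haL hn hv hw hJ⟩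
  obtain ⟨hVlaw, hcond⟩ :=
    GroupLinear.condDistrib_ae_eq_regressionLaw hQ hr hX hθ hV hindep hlaw
  have hpos : ∀ᵐ s ∂(GroupLinear.varLaw Q), 0 < s := by
    rw [GroupLinear.varLaw, ae_map_iff (by fun_prop) measurableSet_Ioi]
    exact hQ.var_pos
  have hcoord : ∀ {p : ℝ → Prop}, (∀ᵐ s ∂(GroupLinear.varLaw Q), p s) →
      ∀ᵐ v ∂(P.map fun ω i => V i ω), ∀ i, p (v i) := by
    intro p hp
    rw [hVlaw]
    exact ae_all_iff.2 fun i => (measurePreserving_eval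
      (fun _ : Fin n => GroupLinear.varLaw Q) i).quasiMeasurePreserving.ae hp
  -- The exceptional null set is fixed before `m` and `J`, which is why the bins may depend on `v`.
  filter_upwards [hcond, hcoord hpos, hcoord ha] with v hv hv0 hva m J hw hJ
  have : GroupLinear.regressionLaw (GroupLinear.oracleA Q) v = GroupLinear.regressionLaw a v := by
    simp only [GroupLinear.regressionLaw, hva]
  rw [hv, this]
  exact GroupLinear.groupLinearRisk_regressionLaw_le hL haL hn hv0 hw hJ
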